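/- Let $H$ be a nonzero complex Hilbert space and let $T$ be a positive, not necessarily bounded, operator in $H$, i.e. $T$ is a densely defined linear operator with domain $D(T)\subseteq H$, $T=T^*$, and $\langle Tx,x\rangle\ge 0$ for all $x\in D(T)$. Then for every $\varepsilon>0$ there exists a bounded linear operator $S:H\to H$ such that 1. $\|S\|\le\varepsilon$; 2. $T+S$ (with domain $D(T)$) is minimum attaining, i.e. it is a closed densely defined operator and there is $x_0\in D(T)$ with $\|x_0\|=1$ and $\|(T+S)x_0\|=\inf\{\|(T+S)x\| : x\in D(T),\ \|x\|=1\}$; 3. $\theta(T+S,T)\le\varepsilon$, where $\theta(A,B)=\|P_{G(A)}-P_{G(B)}\|$ is the gap between closed operators $A,B$ in $H$, and $P_{G(A)}$ is the orthogonal projection of the Hilbert space $H\oplus H$ onto the graph $G(A)$ of $A$. -/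

import Mathlib

namespace LinearPMap

variable {E F : Type*}
  [NormedAddCommGroup E] [InnerProductSpace ℂ E]
  [NormedAddCommGroup F] [InnerProductSpace ℂ F]

/-- A positive (possibly unbounded) operator: `T = T*` and `⟨T x, x⟩ ≥ 0` on the domain of `T`.
Mathlib's `IsSelfAdjoint T` means `T† = T` with equality of domains, and it implies that `T` is
densely defined (`IsSelfAdjoint.dense_domain`) and closed (`IsSelfAdjoint.isClosed`).
For self-adjoint `T` the number `⟨T x, x⟩` is real. -/
def IsPositiveOp [CompleteSpace E] (T : E →ₗ.[ℂ] E) : Prop :=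
  IsSelfAdjoint T ∧ ∀ x : T.domain, 0 ≤ (inner ℂ (T x) (x : E)).re

/-- The minimum modulus `m(T) = inf {‖T x‖ : x ∈ D(T), ‖x‖ = 1}`. -/
noncomputable def minModulus (T : E →ₗ.[ℂ] F) : ℝ :=
  sInf {r : ℝ | ∃ x : T.domain, ‖(x : E)‖ = 1 ∧ ‖T x‖ = r}

/-- A closed densely defined operator is minimum attaining if `‖T x₀‖ = m(T)` for some unit vector
`x₀` of its domain. Closedness and density of the domain are part of the definition. -/
structure IsMinimumAttaining (T : E →ₗ.[ℂ] F) : Prop where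
  isClosed : T.IsClosed
  dense_domain : Dense (T.domain : Set E)
  attains : ∃ x₀ : T.domain, ‖(x₀ : E)‖ = 1 ∧ ‖T x₀‖ = T.minModulus

/-- The graph `{(x, T x) : x ∈ D(T)}` as a subspace of the Hilbert space direct sum of `E` and `F`
(the product with the norm `(‖x‖² + ‖y‖²)^(1/2)`). -/
noncomputable def hilbertGraph (T : E →ₗ.[ℂ] F) : Submodule ℂ (WithLp 2 (E × F)) :=
  T.graph.map (WithLp.linearEquiv 2 ℂ (E × F)).symm.toLinearMap

/-- The gap `θ(A, B) = ‖P_{G(A)} - P_{G(B)}‖`, where `P_M` is the orthogonal projection of the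
Hilbert space direct sum of `E` and `F` onto `M`. It is meant for closed operators, whose graph is
equal to its closure (see `topologicalClosure_hilbertGraph`); the closure is written only so that
the projection is defined without a proof of closedness. -/
noncomputable def gap [CompleteSpace E] [CompleteSpace F] (A B : E →ₗ.[ℂ] F) : ℝ :=
  ‖A.hilbertGraph.topologicalClosure.starProjection -
    B.hilbertGraph.topologicalClosure.starProjection‖

theorem topologicalClosure_hilbertGraph {T : E →ₗ.[ℂ] F} (hT : T.IsClosed) :
    T.hilbertGraph.topologicalClosure = T.hilbertGraph := by
  refine IsClosed.submodule_topologicalClosure_eq ?_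
  rw [hilbertGraph, Submodule.map_coe, LinearEquiv.coe_coe, LinearEquiv.image_eq_preimage_symm]
  exact IsClosed.preimage (WithLp.prod_continuous_ofLp 2 E F) hT

/-- The sum `T + S` of an operator `T` and an everywhere defined bounded operator `S`,
with domain `D(T) ∩ D(S)`, that is `D(T)`. -/
noncomputable def addBounded (T : E →ₗ.[ℂ] F) (S : E →L[ℂ] F) : E →ₗ.[ℂ] F :=
  T + (S : E →ₗ[ℂ] F).toPMap ⊤

end LinearPMap

/-!
Let `m = m(T)`. For a positive operator the bound `m ‖x‖ ≤ ‖T x‖` improves to the form bound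
`m ‖x‖² ≤ ⟪T x, x⟫` (`IsPositiveOp.minModulus_mul_sq_le`): if `m > 0` then `T` is onto, and
positivity of the form at `x - m • z`, where `T z = x`, is the claim. No spectral theorem is needed.

Choose a unit vector `x₀ ∈ D(T)` with `‖T x₀‖ < m + η` and put `a = ⟪T x₀, x₀⟫`,
`w = T x₀ - a x₀`. The form bound gives `m ≤ a`, hence `‖w‖² = ‖T x₀‖² - a² < (m + η)² - m²`: an
approximate minimizer is an approximate eigenvector. So with `P` the projection onto `ℂ x₀`, the
operator `m P + (1 - P) T (1 - P)` differs from `T` by a finite rank operator (`decoupling`) whose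
norm is at most `|m - a| + 2 ‖w‖`. Its quadratic form is still bounded below by `m`, and it sends
`x₀` to `m x₀`, so it attains its minimum modulus `m` at `x₀`
(`IsPositiveOp.isMinimumAttaining_addBounded_decoupling`).

Finally the gap between `T + S` and `T` is at most `2 ‖S‖` (`gap_addBounded_le`), because the shear
`(x, y) ↦ (x, y + S x)` carries one graph onto the other and moves `u` by at most `‖S‖ ‖u‖`.
-/

namespace LinearPMap

/-! ### Minimum modulus and bounded perturbations -/

section Basic

variable {E F : Type*}
  [NormedAddCommGroup E] [InnerProductSpace ℂ E]
  [NormedAddCommGroup F] [InnerProductSpace ℂ F]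

theorem minModulus_mul_norm_le (T : E →ₗ.[ℂ] F) (x : T.domain) :
    T.minModulus * ‖(x : E)‖ ≤ ‖T x‖ := by
  rcases eq_or_ne (x : E) 0 with hx | hx
  · simp [hx]
  have hx' : 0 < ‖(x : E)‖ := norm_pos_iff.2 hx
  have hle : T.minModulus ≤ ‖T (((‖(x : E)‖⁻¹ : ℝ) : ℂ) • x)‖ := by
    refine csInf_le ⟨0, ?_⟩ ⟨((‖(x : E)‖⁻¹ : ℝ) : ℂ) • x, ?_, rfl⟩
    · rintro _ ⟨y, -, rfl⟩
      exact norm_nonneg _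
    · simp [norm_smul, hx'.ne']
  rw [LinearPMap.map_smul, norm_smul, Complex.norm_real, Real.norm_of_nonneg (by positivity),
    inv_mul_eq_div, le_div_iff₀ hx'] at hle
  exact hle

theorem exists_norm_lt_of_minModulus_lt [Nontrivial E] {T : E →ₗ.[ℂ] F}
    (hT : Dense (T.domain : Set E)) {r : ℝ} (hr : T.minModulus < r) :
    ∃ x : T.domain, ‖(x : E)‖ = 1 ∧ ‖T x‖ < r := by
  obtain ⟨y, hy, hy0⟩ : ∃ y ∈ T.domain, y ≠ 0 := by
    by_contra! h
    obtain ⟨z, hz⟩ := exists_ne (0 : E)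
    have : (T.domain : Set E) ⊆ {0} := fun y hy ↦ h y hy
    exact hz (closure_minimal this isClosed_singleton (hT z))
  have hy' : 0 < ‖y‖ := norm_pos_iff.2 hy0
  obtain ⟨_, ⟨x, hx, rfl⟩, hlt⟩ := exists_lt_of_csInf_lt
    (s := {r : ℝ | ∃ x : T.domain, ‖(x : E)‖ = 1 ∧ ‖T x‖ = r})
    ⟨_, ((‖y‖⁻¹ : ℝ) : ℂ) • (⟨y, hy⟩ : T.domain), by simp [norm_smul, hy'.ne'], rfl⟩ hr
  exact ⟨x, hx, hlt⟩

theorem minModulus_eq_of_le_of_norm_eq {T : E →ₗ.[ℂ] F} {c : ℝ}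
    (h : ∀ x : T.domain, c * ‖(x : E)‖ ≤ ‖T x‖) {x₀ : T.domain} (hx₀ : ‖(x₀ : E)‖ = 1)
    (hc : ‖T x₀‖ = c) : T.minModulus = c := by
  refine le_antisymm ?_ (le_csInf ⟨c, x₀, hx₀, hc⟩ ?_)
  · simpa [hx₀, hc] using T.minModulus_mul_norm_le x₀
  · rintro _ ⟨x, hx, rfl⟩
    simpa [hx] using h x

theorem minModulus_nonneg (T : E →ₗ.[ℂ] F) : 0 ≤ T.minModulus := by
  refine Real.sInf_nonneg ?_
  rintro _ ⟨x, -, rfl⟩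
  exact norm_nonneg _

@[simp]
theorem addBounded_domain (T : E →ₗ.[ℂ] F) (S : E →L[ℂ] F) :
    (T.addBounded S).domain = T.domain := by
  simp [addBounded, LinearPMap.add_domain]

theorem addBounded_apply (T : E →ₗ.[ℂ] F) (S : E →L[ℂ] F) (x : (T.addBounded S).domain)
    (hx : (x : E) ∈ T.domain) : T.addBounded S x = T ⟨x, hx⟩ + S x := rfl

theorem mem_graph_addBounded_iff {T : E →ₗ.[ℂ] F} {S : E →L[ℂ] F} {p : E × F} :
    p ∈ (T.addBounded S).graph ↔ (p.1, p.2 - S p.1) ∈ T.graph := by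
  constructor
  · intro h
    obtain ⟨x, hx, hp⟩ := LinearPMap.mem_graph_iff _ |>.1 h
    have hd : (x : E) ∈ T.domain := by simpa using x.2
    rw [addBounded_apply T S x hd] at hp
    exact (LinearPMap.mem_graph_iff _).2 ⟨⟨x, hd⟩, hx, by simp [← hp, ← hx]⟩
  · intro h
    obtain ⟨x, hx, hp⟩ := LinearPMap.mem_graph_iff _ |>.1 h
    have hd : (x : E) ∈ (T.addBounded S).domain := by simp
    refine (LinearPMap.mem_graph_iff _).2 ⟨⟨x, hd⟩, hx, ?_⟩
    rw [addBounded_apply T S ⟨x, hd⟩ x.2]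
    change T x + S x = p.2
    rw [hp, hx, sub_add_cancel]

theorem IsClosed.addBounded {T : E →ₗ.[ℂ] F} (hT : T.IsClosed) (S : E →L[ℂ] F) :
    (T.addBounded S).IsClosed := by
  have hc : Continuous fun p : E × F ↦ (p.1, p.2 - S p.1) := by fun_prop
  have h := _root_.IsClosed.preimage hc hT
  refine (congrArg _root_.IsClosed ?_).mp h
  ext p
  exact mem_graph_addBounded_iff.symm

theorem mem_hilbertGraph_iff {T : E →ₗ.[ℂ] F} {u : WithLp 2 (E × F)} :
    u ∈ T.hilbertGraph ↔ (u.fst, u.snd) ∈ T.graph := by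
  constructor
  · rintro ⟨p, hp, rfl⟩
    exact hp
  · intro h
    exact ⟨_, h, rfl⟩

end Basic

/-! ### Gap of a bounded perturbation -/

section Gap

/-- If every vector of `M` and of `N` is `δ`-close, relative to its norm, to the other subspace,
then the identity `P - Q = P (1 - Q) - (1 - P) Q` bounds the difference of the two orthogonal
projections by `2 * δ`. -/
theorem _root_.Submodule.norm_starProjection_sub_le {V : Type*} [NormedAddCommGroup V]
    [InnerProductSpace ℂ V] (M N : Submodule ℂ V) [M.HasOrthogonalProjection]
    [N.HasOrthogonalProjection] {δ : ℝ} (hδ : 0 ≤ δ)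
    (hM : ∀ u ∈ M, ∃ v ∈ N, ‖u - v‖ ≤ δ * ‖u‖) (hN : ∀ u ∈ N, ∃ v ∈ M, ‖u - v‖ ≤ δ * ‖u‖) :
    ‖M.starProjection - N.starProjection‖ ≤ 2 * δ := by
  have hcon (K : Submodule ℂ V) [K.HasOrthogonalProjection] (u : V) :
      ‖u - K.starProjection u‖ ≤ ‖u‖ := by
    have := Kᗮ.norm_starProjection_apply_le u
    rwa [K.starProjection_orthogonal_val] at this
  refine ContinuousLinearMap.opNorm_le_bound _ (by positivity) fun u ↦ ?_
  set q := N.starProjection u with hq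
  set r := u - q with hr
  set p := M.starProjection r with hp
  have hpM : p ∈ M := M.starProjection_apply_mem r
  have hqN : q ∈ N := N.starProjection_apply_mem u
  have h1 : ‖p‖ ≤ δ * ‖u‖ := by
    obtain ⟨v, hv, hpv⟩ := hM p hpM
    have e1 : inner ℂ p p = inner ℂ p r := by
      have : inner ℂ p (r - p) = 0 :=
        (M.mem_orthogonal _).1 (M.sub_starProjection_mem_orthogonal r) p hpM
      rw [inner_sub_right, sub_eq_zero] at this
      exact this.symm
    have e2 : inner ℂ v r = 0 :=
      (N.mem_orthogonal _).1 (N.sub_starProjection_mem_orthogonal u) v hv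
    have e3 : ‖p‖ * ‖p‖ ≤ δ * ‖p‖ * ‖u‖ := by
      calc ‖p‖ * ‖p‖ = ‖inner ℂ p p‖ := by
            rw [inner_self_eq_norm_sq_to_K, ← sq]; simp
        _ = ‖inner ℂ (p - v) r‖ := by rw [inner_sub_left, e2, sub_zero, e1]
        _ ≤ ‖p - v‖ * ‖r‖ := norm_inner_le_norm _ _
        _ ≤ δ * ‖p‖ * ‖u‖ := mul_le_mul hpv (hcon N u) (norm_nonneg _) (by positivity)
    rcases (norm_nonneg p).eq_or_lt with h0 | h0
    · rw [← h0]; positivity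
    · nlinarith
  have h2 : ‖q - M.starProjection q‖ ≤ δ * ‖u‖ := by
    obtain ⟨v, hv, hqv⟩ := hN q hqN
    calc ‖q - M.starProjection q‖ = ‖(q - v) - M.starProjection (q - v)‖ := by
          rw [_root_.map_sub, M.starProjection_eq_self_iff.2 hv]; congr 1; abel
      _ ≤ ‖q - v‖ := hcon M _
      _ ≤ δ * ‖q‖ := hqv
      _ ≤ δ * ‖u‖ := by gcongr; exact N.norm_starProjection_apply_le u
  have e : (M.starProjection - N.starProjection) u = p - (q - M.starProjection q) := by
    simp only [hp, hr, _root_.map_sub, _root_.sub_apply, ← hq]; abel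
  rw [e]
  linarith [norm_sub_le p (q - M.starProjection q)]

variable {E F : Type*}
  [NormedAddCommGroup E] [InnerProductSpace ℂ E] [CompleteSpace E]
  [NormedAddCommGroup F] [InnerProductSpace ℂ F] [CompleteSpace F]

theorem gap_addBounded_le {T : E →ₗ.[ℂ] F} (hT : T.IsClosed) (S : E →L[ℂ] F) :
    gap (T.addBounded S) T ≤ 2 * ‖S‖ := by
  have hshift (u : WithLp 2 (E × F)) : ‖WithLp.toLp 2 ((0 : E), S u.fst)‖ ≤ ‖S‖ * ‖u‖ := by
    rw [WithLp.prod_norm_eq_of_L2]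
    simp only [WithLp.toLp_fst, WithLp.toLp_snd, norm_zero, ne_eq, OfNat.ofNat_ne_zero,
      not_false_eq_true, zero_pow, zero_add, norm_nonneg, Real.sqrt_sq]
    refine (S.le_opNorm _).trans ?_
    gcongr
    exact WithLp.norm_fst_le E u
  unfold gap
  refine Submodule.norm_starProjection_sub_le _ _ (norm_nonneg S) ?_ ?_
  · rw [topologicalClosure_hilbertGraph hT, topologicalClosure_hilbertGraph (hT.addBounded S)]
    intro u hu
    refine ⟨u - WithLp.toLp 2 ((0 : E), S u.fst), ?_, by simpa using hshift u⟩
    rw [mem_hilbertGraph_iff] at hu ⊢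
    simpa using mem_graph_addBounded_iff.1 hu
  · rw [topologicalClosure_hilbertGraph hT, topologicalClosure_hilbertGraph (hT.addBounded S)]
    intro u hu
    refine ⟨u + WithLp.toLp 2 ((0 : E), S u.fst), ?_, by simpa using hshift u⟩
    rw [mem_hilbertGraph_iff] at hu ⊢
    rw [mem_graph_addBounded_iff]
    simpa using hu

end Gap

/-! ### The lower bound of a positive operator -/

section Positive

variable {H : Type*} [NormedAddCommGroup H] [InnerProductSpace ℂ H] [CompleteSpace H]

theorem _root_.IsSelfAdjoint.inner_linearPMap_comm {T : H →ₗ.[ℂ] H} (hT : IsSelfAdjoint T)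
    (x y : T.domain) : inner ℂ (T x) (y : H) = inner ℂ (x : H) (T y) := by
  have h := LinearPMap.adjoint_isFormalAdjoint hT.dense_domain
  rw [LinearPMap.isSelfAdjoint_def.1 hT] at h
  exact h x y

/-- A self-adjoint operator that is bounded below maps its domain onto the whole space: its range
is closed, and the orthogonal complement of the range is its kernel. -/
theorem _root_.IsSelfAdjoint.exists_linearPMap_apply_eq {T : H →ₗ.[ℂ] H} (hT : IsSelfAdjoint T)
    {c : ℝ} (hc : 0 < c) (h : ∀ x : T.domain, c * ‖(x : H)‖ ≤ ‖T x‖) (y : H) :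
    ∃ x : T.domain, T x = y := by
  let g : T.graph →L[ℂ] H := (ContinuousLinearMap.snd ℂ H H).comp T.graph.subtypeL
  have : CompleteSpace T.graph := hT.isClosed.completeSpace_coe
  have hanti : AntilipschitzWith (c⁻¹ + 1).toNNReal g := by
    refine ContinuousLinearMap.antilipschitz_of_bound g fun p ↦ ?_
    obtain ⟨x, hx, hp⟩ := LinearPMap.mem_graph_iff _ |>.1 p.2
    have h1 := h x
    have h2 : ‖(x : H)‖ ≤ c⁻¹ * ‖T x‖ := by rwa [inv_mul_eq_div, le_div_iff₀' hc]
    have hn := norm_nonneg (T x)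
    rw [Real.coe_toNNReal _ (by positivity)]
    change max ‖(p : H × H).1‖ ‖(p : H × H).2‖ ≤ (c⁻¹ + 1) * ‖(p : H × H).2‖
    rw [← hx, ← hp]
    have : 0 ≤ c⁻¹ * ‖T x‖ := by positivity
    exact max_le (by linarith) (by linarith)
  have hclosed : _root_.IsClosed (g.range : Set H) := by
    have := hanti.isClosed_range g.uniformContinuous
    rwa [← ContinuousLinearMap.coe_coe, ← LinearMap.coe_range] at this
  have hmem (x : T.domain) : T x ∈ g.range :=
    ⟨⟨((x : H), T x), T.mem_graph x⟩, rfl⟩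
  have htop : g.range = ⊤ := by
    have := hclosed.completeSpace_coe
    rw [← Submodule.orthogonal_eq_bot_iff, Submodule.eq_bot_iff]
    intro z hz
    have hz0 (x : T.domain) : inner ℂ (0 : H) (x : H) = inner ℂ z (T x) := by
      rw [inner_zero_left, Submodule.inner_left_of_mem_orthogonal (hmem x) hz]
    have hzd : z ∈ T†.domain := LinearPMap.mem_adjoint_domain_of_exists z ⟨0, hz0⟩
    have hz1 : T† ⟨z, hzd⟩ = 0 :=
      LinearPMap.adjoint_apply_eq hT.dense_domain ⟨z, hzd⟩ hz0
    have key : ∀ (A : H →ₗ.[ℂ] H), A = T → ∀ hA : z ∈ A.domain, A ⟨z, hA⟩ = 0 → z = 0 := by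
      rintro A rfl hA h0
      have := h ⟨z, hA⟩
      rw [h0, norm_zero] at this
      exact norm_le_zero_iff.1 (nonpos_of_mul_nonpos_right this hc)
    exact key _ (LinearPMap.isSelfAdjoint_def.1 hT) hzd hz1
  obtain ⟨⟨p, hpT⟩, hp⟩ : y ∈ g.range := htop ▸ Submodule.mem_top
  obtain ⟨x, -, hx⟩ := LinearPMap.mem_graph_iff _ |>.1 hpT
  exact ⟨x, hx.trans hp⟩

/-- For a positive operator the lower bound `m(T)` of `‖T x‖` on unit vectors is also a lower bound
of the quadratic form. -/
theorem IsPositiveOp.minModulus_mul_sq_le {T : H →ₗ.[ℂ] H} (hT : T.IsPositiveOp) (x : T.domain) :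
    T.minModulus * ‖(x : H)‖ ^ 2 ≤ (inner ℂ (T x) (x : H)).re := by
  rcases T.minModulus_nonneg.eq_or_lt with h0 | hm
  · simpa [← h0] using hT.2 x
  set m := T.minModulus
  -- Positivity of the form at `x - m • T⁻¹ x` gives the bound, since `⟪x, T⁻¹ x⟫ ≤ ‖x‖² / m`.
  obtain ⟨z, hz⟩ := hT.1.exists_linearPMap_apply_eq hm T.minModulus_mul_norm_le x
  have hpos := hT.2 (x - (m : ℂ) • z)
  have hxx : inner ℂ (x : H) (x : H) = ((‖(x : H)‖ ^ 2 : ℝ) : ℂ) := by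
    rw [inner_self_eq_norm_sq_to_K]; simp
  have hxz : inner ℂ (T x) (z : H) = ((‖(x : H)‖ ^ 2 : ℝ) : ℂ) := by
    rw [hT.1.inner_linearPMap_comm, hz, hxx]
  have hzz : m * (inner ℂ (x : H) (z : H)).re ≤ ‖(x : H)‖ ^ 2 := by
    have h1 : (inner ℂ (x : H) (z : H)).re ≤ ‖(x : H)‖ * ‖(z : H)‖ := re_inner_le_norm (𝕜 := ℂ) _ _
    have h2 := T.minModulus_mul_norm_le z
    rw [hz] at h2
    nlinarith [norm_nonneg (x : H)]
  have e : (inner ℂ (T (x - (m : ℂ) • z)) ((x - (m : ℂ) • z : T.domain) : H)).re =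
      (inner ℂ (T x) (x : H)).re - 2 * m * ‖(x : H)‖ ^ 2 +
        m * (m * (inner ℂ (x : H) (z : H)).re) := by
    rw [LinearPMap.map_sub, LinearPMap.map_smul, hz, Submodule.coe_sub, Submodule.coe_smul]
    simp only [inner_sub_left, inner_sub_right, inner_smul_left, inner_smul_right, hxz, hxx,
      Complex.conj_ofReal, Complex.sub_re, Complex.re_ofReal_mul, Complex.ofReal_re]
    ring
  rw [e] at hpos
  nlinarith

end Positive

/-! ### Splitting off an approximate minimizer -/

section Perturbation

variable {H : Type*} [NormedAddCommGroup H] [InnerProductSpace ℂ H]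

/-- The finite rank operator `x ↦ (m - a) ⟪x₀, x⟫ x₀ - ⟪w, x⟫ x₀ - ⟪x₀, x⟫ w`. When `x₀` is a unit
vector of `D(T)`, `a = ⟪T x₀, x₀⟫` and `w = T x₀ - a x₀`, adding it to a symmetric operator `T`
removes the off-diagonal blocks of `T` with respect to `ℂ x₀ ⊕ x₀ᗮ` and replaces the
diagonal entry `a` by `m`. -/
noncomputable def decoupling (x₀ w : H) (a m : ℝ) : H →L[ℂ] H :=
  ((m - a : ℝ) : ℂ) • (innerSL ℂ x₀).smulRight x₀ - (innerSL ℂ w).smulRight x₀ -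
    (innerSL ℂ x₀).smulRight w

theorem decoupling_apply (x₀ w : H) (a m : ℝ) (x : H) :
    decoupling x₀ w a m x = ((m - a : ℝ) : ℂ) • (inner ℂ x₀ x • x₀) - inner ℂ w x • x₀ -
      inner ℂ x₀ x • w := rfl

theorem norm_decoupling_le {x₀ : H} (hx₀ : ‖x₀‖ = 1) (w : H) (a m : ℝ) :
    ‖decoupling x₀ w a m‖ ≤ |m - a| + 2 * ‖w‖ := by
  refine (norm_sub_le _ _).trans ((add_le_add_left (norm_sub_le _ _) _).trans ?_)
  rw [norm_smul]
  simp only [ContinuousLinearMap.norm_smulRight_apply, innerSL_apply_norm, hx₀, Complex.norm_real,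
    Real.norm_eq_abs]
  linarith

variable [CompleteSpace H] {T : H →ₗ.[ℂ] H}

/-- With `y = x - ⟪x₀, x⟫ x₀`, the form of the perturbed operator at `x` is
`⟪T y, y⟫ + m(T) |⟪x₀, x⟫|²`, so the lower bound `m(T)` persists. -/
theorem IsPositiveOp.minModulus_mul_sq_le_addBounded_decoupling (hT : T.IsPositiveOp)
    {x₀ : T.domain} (hx₀ : ‖(x₀ : H)‖ = 1) {a : ℝ} (ha : inner ℂ (T x₀) (x₀ : H) = (a : ℂ))
    (x : T.domain) :
    T.minModulus * ‖(x : H)‖ ^ 2 ≤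
      (inner ℂ (T x + decoupling (x₀ : H) (T x₀ - (a : ℂ) • (x₀ : H)) a T.minModulus x)
        (x : H)).re := by
  have hone : inner ℂ (x₀ : H) (x₀ : H) = (1 : ℂ) := by
    rw [inner_self_eq_norm_sq_to_K, hx₀]; simp
  set m := T.minModulus
  set c : ℂ := inner ℂ (x₀ : H) (x : H) with hc
  set y : T.domain := x - c • x₀ with hy
  have hxy : x = y + c • x₀ := by simp [hy]
  have hxy' : (x : H) = y + c • (x₀ : H) := by simp [hy]
  have hyo : inner ℂ (x₀ : H) (y : H) = 0 := by
    rw [hy, Submodule.coe_sub, Submodule.coe_smul, inner_sub_right, inner_smul_right, hone, ← hc,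
      mul_one, sub_self]
  have hyo' : inner ℂ (y : H) (x₀ : H) = 0 := inner_eq_zero_symm.1 hyo
  have hv : T x + decoupling (x₀ : H) (T x₀ - (a : ℂ) • (x₀ : H)) a m x =
      T y + ((m : ℂ) * c - inner ℂ (x₀ : H) (T y)) • (x₀ : H) := by
    have hw : inner ℂ (T x₀ - (a : ℂ) • (x₀ : H)) (x : H) = inner ℂ (x₀ : H) (T y) := by
      rw [hxy']
      simp only [inner_sub_left, inner_add_right, inner_smul_left, inner_smul_right, hyo, hone, ha,
        Complex.conj_ofReal, hT.1.inner_linearPMap_comm x₀ y]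
      ring
    rw [decoupling_apply, hw, ← hc]
    conv_lhs => rw [hxy, LinearPMap.map_add, LinearPMap.map_smul]
    push_cast
    module
  have hn : ‖(x : H)‖ ^ 2 = ‖(y : H)‖ ^ 2 + ‖c‖ ^ 2 := by
    have := norm_add_sq_eq_norm_sq_add_norm_sq_of_inner_eq_zero (𝕜 := ℂ) (y : H) (c • (x₀ : H))
      (by rw [inner_smul_right, hyo', mul_zero])
    rw [← hxy', norm_smul, hx₀, mul_one] at this
    rw [sq, this]; ring
  have hf : inner ℂ (T y + ((m : ℂ) * c - inner ℂ (x₀ : H) (T y)) • (x₀ : H)) (x : H) =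
      inner ℂ (T y) (y : H) + ((m * ‖c‖ ^ 2 : ℝ) : ℂ) := by
    rw [hxy']
    simp only [inner_add_left, inner_add_right, inner_smul_left, inner_smul_right, hyo, hone,
      _root_.map_sub, map_mul, Complex.conj_ofReal, inner_conj_symm]
    have : (starRingEnd ℂ) c * c = ((‖c‖ ^ 2 : ℝ) : ℂ) := by
      rw [Complex.conj_mul']; push_cast; rfl
    push_cast at this ⊢
    linear_combination (m : ℂ) * this
  rw [hv, hf, Complex.add_re, Complex.ofReal_re, hn, mul_add]
  gcongr
  exact hT.minModulus_mul_sq_le y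

theorem IsPositiveOp.isMinimumAttaining_addBounded_decoupling (hT : T.IsPositiveOp)
    {x₀ : T.domain} (hx₀ : ‖(x₀ : H)‖ = 1) {a : ℝ} (ha : inner ℂ (T x₀) (x₀ : H) = (a : ℂ)) :
    (T.addBounded (decoupling (x₀ : H) (T x₀ - (a : ℂ) • (x₀ : H)) a
      T.minModulus)).IsMinimumAttaining := by
  set w := T x₀ - (a : ℂ) • (x₀ : H) with hw
  set S := decoupling (x₀ : H) w a T.minModulus with hS
  have hone : inner ℂ (x₀ : H) (x₀ : H) = (1 : ℂ) := by
    rw [inner_self_eq_norm_sq_to_K, hx₀]; simp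
  have hd : (x₀ : H) ∈ (T.addBounded S).domain := by simp
  have happ : T.addBounded S ⟨x₀, hd⟩ = (T.minModulus : ℂ) • (x₀ : H) := by
    have hwx : inner ℂ w (x₀ : H) = (0 : ℂ) := by
      rw [hw, inner_sub_left, inner_smul_left, ha, hone, Complex.conj_ofReal, mul_one, sub_self]
    rw [addBounded_apply T S ⟨x₀, hd⟩ x₀.2, hS, decoupling_apply, hwx, hone, hw]
    push_cast
    module
  have hnorm : ‖T.addBounded S ⟨x₀, hd⟩‖ = T.minModulus := by
    rw [happ, norm_smul, hx₀, mul_one, Complex.norm_real, Real.norm_of_nonneg T.minModulus_nonneg]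
  have hbound (x : (T.addBounded S).domain) :
      T.minModulus * ‖(x : H)‖ ≤ ‖T.addBounded S x‖ := by
    have hx : (x : H) ∈ T.domain := by simpa using x.2
    have h1 := hT.minModulus_mul_sq_le_addBounded_decoupling hx₀ ha ⟨x, hx⟩
    rw [addBounded_apply T S x hx]
    have h2 : (inner ℂ (T ⟨x, hx⟩ + S x) (x : H)).re ≤ ‖T ⟨x, hx⟩ + S x‖ * ‖(x : H)‖ :=
      re_inner_le_norm (𝕜 := ℂ) _ _
    have h3 := h1.trans h2
    rcases (norm_nonneg (x : H)).eq_or_lt with h0 | h0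
    · rw [← h0, mul_zero]; exact norm_nonneg _
    · simp only at h3
      rw [sq, ← mul_assoc] at h3
      exact le_of_mul_le_mul_right h3 h0
  exact ⟨hT.1.isClosed.addBounded S, by simpa using hT.1.dense_domain,
    ⟨x₀, hd⟩, hx₀, hnorm.trans (minModulus_eq_of_le_of_norm_eq hbound hx₀ hnorm).symm⟩

end Perturbation

end LinearPMap

/-! ### Approximation by minimum attaining operators -/

theorem theorem3p2 {H : Type*} [NormedAddCommGroup H] [InnerProductSpace ℂ H] [CompleteSpace H]
    [Nontrivial H] (T : H →ₗ.[ℂ] H) (hT : T.IsPositiveOp) (ε : ℝ) (hε : 0 < ε) :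
    ∃ S : H →L[ℂ] H, ‖S‖ ≤ ε ∧
      (T.addBounded S).IsMinimumAttaining ∧
      LinearPMap.gap (T.addBounded S) T ≤ ε := by
  have hm := T.minModulus_nonneg
  set m := T.minModulus with hm_def
  -- `η` is chosen so that `η ≤ δ` and `(m + η) ^ 2 - m ^ 2 ≤ δ ^ 2`; then `‖S‖ ≤ 3 * δ = ε / 2`.
  set δ := ε / 6 with hδ_def
  have hδ : 0 < δ := by positivity
  set η := δ ^ 2 / (2 * m + δ) with hη_def
  have hη : 0 < η := by positivity
  have hηm : η * (2 * m + δ) = δ ^ 2 := div_mul_cancel₀ _ (by positivity)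
  have hηδ : η ≤ δ := by
    rw [hη_def, div_le_iff₀ (by positivity)]
    nlinarith
  obtain ⟨x₀, hx₀, hlt⟩ := LinearPMap.exists_norm_lt_of_minModulus_lt hT.1.dense_domain
    (show T.minModulus < m + η by linarith)
  set a := (inner ℂ (T x₀) (x₀ : H)).re with ha_def
  have ha : inner ℂ (T x₀) (x₀ : H) = (a : ℂ) := by
    refine (Complex.conj_eq_iff_re.1 ?_).symm
    rw [inner_conj_symm, hT.1.inner_linearPMap_comm]
  have hma : m ≤ a := by simpa [hx₀] using hT.minModulus_mul_sq_le x₀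
  have haη : a ≤ m + η := by
    have : a ≤ ‖T x₀‖ * ‖(x₀ : H)‖ := re_inner_le_norm (𝕜 := ℂ) _ _
    rw [hx₀, mul_one] at this
    linarith
  set w := T x₀ - (a : ℂ) • (x₀ : H) with hw
  have hwsq : ‖w‖ ^ 2 = ‖T x₀‖ ^ 2 - a ^ 2 := by
    rw [hw, norm_sub_sq (𝕜 := ℂ), inner_smul_right, ha, norm_smul, hx₀, mul_one, Complex.norm_real,
      Real.norm_eq_abs, sq_abs, ← Complex.ofReal_mul]
    simp only [RCLike.re_to_complex, Complex.ofReal_re]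
    ring
  have hwδ : ‖w‖ ≤ δ := by
    refine abs_le_of_sq_le_sq' ?_ hδ.le |>.2
    have : ‖T x₀‖ ^ 2 ≤ (m + η) ^ 2 := pow_le_pow_left₀ (norm_nonneg _) hlt.le 2
    nlinarith
  have hS : ‖LinearPMap.decoupling (x₀ : H) w a m‖ ≤ ε / 2 := by
    refine (LinearPMap.norm_decoupling_le hx₀ w a m).trans ?_
    rw [abs_of_nonpos (by linarith)]
    linarith
  refine ⟨LinearPMap.decoupling (x₀ : H) w a m, by linarith,
    hT.isMinimumAttaining_addBounded_decoupling hx₀ ha, ?_⟩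
  linarith [LinearPMap.gap_addBounded_le hT.1.isClosed (LinearPMap.decoupling (x₀ : H) w a m)]
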